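/- Let $q$ be a nonzero rational number, let $m$ be a rational number with $m\neq 0$ and $m\neq q^2$, and let $(x_1,y_1)$ be a rational point on the curve $\mathcal D_m\colon (X^2-q)(Y^2-q)=m$. Let $E_m$ be the elliptic curve $W^2=T^3+(4q^2-2m)T^2+m^2T$ over $\mathbb{Q}$, and let $f\colon \mathcal D_m\to E_m$ be the birational map $(x,y)\mapsto (T,W)$ given by \[ T=(y_1^2-q)\cdot\frac{2x_1(y^2-q)x+(x_1^2+q)y^2+x_1^2y_1^2-2x_1^2q-y_1^2q}{(y-y_1)^2},\qquad W=T\cdot\frac{2y_1x(q-y^2)+2x_1y(q-y_1^2)}{y^2-y_1^2}. \] Let $x\circ f^{-1}$ be the rational function on $E_m$ whose pullback along $f$ is the coordinate function $x$ on $\mathcal D_m$, and let $g$ be the rational function on $E_m$ defined by \[ g=(x_1^2-q)\left((x\circ f^{-1})^2-q\right). \] Then: (1) For all $P,Q\in E_m(\mathbb{Q})$ such that $g$ is regular and nonzero at $P$, $Q$ and $P+Q$, one has $g(P+Q)\equiv g(P)g(Q) \pmod{(\mathbb{Q}^*)^2}$. (2) For all $P,Q\in E_m(\mathbb{Q})$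 such that $g$ is regular and nonzero at $P$ and $Q$, if $P\equiv Q \pmod{2E_m(\mathbb{Q})}$ then $g(P)\equiv g(Q) \pmod{(\mathbb{Q}^*)^2}$. If $q$ is not a square in $\mathbb{Q}$, then $g$ is regular and nonzero at every point of $E_m(\mathbb{Q})$, so that (1) and (2) hold for all $P,Q\in E_m(\mathbb{Q})$. -/

import Mathlib

namespace DqQuad

/-- The affine quartic curve `D_m : (X ^ 2 - q) * (Y ^ 2 - q) = m` over a field. -/
def OnD {K : Type*} [Field K] (q m x y : K) : Prop :=
  (x ^ 2 - q) * (y ^ 2 - q) = m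

/-- The Weierstrass curve `E_m : W ^ 2 = T ^ 3 + (4 * q ^ 2 - 2 * m) * T ^ 2 + m ^ 2 * T`.
Its discriminant is `256 * m ^ 4 * q ^ 2 * (q ^ 2 - m)`. -/
def E (q m : ℚ) : WeierstrassCurve.Affine ℚ where
  a₁ := 0
  a₂ := 4 * q ^ 2 - 2 * m
  a₃ := 0
  a₄ := m ^ 2
  a₆ := 0

/-- The `T`-coordinate of the birational map `f : D_m → E_m` attached to the point `(x₁, y₁)`. -/
def fT {K : Type*} [Field K] (q x₁ y₁ x y : K) : K :=
  (y₁ ^ 2 - q) *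
    ((2 * x₁ * (y ^ 2 - q) * x + (x₁ ^ 2 + q) * y ^ 2 + x₁ ^ 2 * y₁ ^ 2
        - 2 * x₁ ^ 2 * q - y₁ ^ 2 * q) / (y - y₁) ^ 2)

/-- The `W`-coordinate of the birational map `f : D_m → E_m` attached to the point `(x₁, y₁)`. -/
def fW {K : Type*} [Field K] (q x₁ y₁ x y : K) : K :=
  fT q x₁ y₁ x y *
    ((2 * y₁ * x * (q - y ^ 2) + 2 * x₁ * y * (q - y₁ ^ 2)) / (y ^ 2 - y₁ ^ 2))

/-- Homogeneous coordinates of a rational point of `E_m` in the projective plane. -/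
def coords {q m : ℚ} : (E q m).Point → Fin 3 → ℚ
  | .zero => ![0, 1, 0]
  | .some T W _ => ![T, W, 1]

/-- Forms `A`, `B` over `ℚ` of the same degree `n` such that the rational function `A / B` on
`E_m` is `x ∘ f⁻¹`: its pullback along `f` is the coordinate function `x` of `D_m`.  This is
tested at the points of `D_m` over an algebraic closure of `ℚ` where no denominator in the
formulas for `f` vanishes. -/
def RepresentsXInv (q m x₁ y₁ : ℚ) (n : ℕ) (A B : MvPolynomial (Fin 3) ℚ) : Prop :=
  A.IsHomogeneous n ∧ B.IsHomogeneous n ∧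
    ∀ x y : AlgebraicClosure ℚ, OnD (q : AlgebraicClosure ℚ) m x y → y ^ 2 ≠ (y₁ : AlgebraicClosure ℚ) ^ 2 →
      MvPolynomial.aeval ![fT (q : AlgebraicClosure ℚ) x₁ y₁ x y, fW (q : AlgebraicClosure ℚ) x₁ y₁ x y, 1] A =
        x * MvPolynomial.aeval
          ![fT (q : AlgebraicClosure ℚ) x₁ y₁ x y, fW (q : AlgebraicClosure ℚ) x₁ y₁ x y, 1] B

/-- The rational function `x ∘ f⁻¹` on `E_m` is regular at the rational point `P`, with value `v`:
some representation `A / B` of it has `B (P) ≠ 0` and `A (P) / B (P) = v`. -/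
def XInvValue (q m x₁ y₁ : ℚ) (P : (E q m).Point) (v : ℚ) : Prop :=
  ∃ (n : ℕ) (A B : MvPolynomial (Fin 3) ℚ), RepresentsXInv q m x₁ y₁ n A B ∧
    MvPolynomial.eval (coords P) B ≠ 0 ∧
    v = MvPolynomial.eval (coords P) A / MvPolynomial.eval (coords P) B

/-- The rational function `g = (x₁ ^ 2 - q) * ((x ∘ f⁻¹) ^ 2 - q)` on `E_m` is regular at the
rational point `P`, with value `a`; the poles of `g` are those of `x ∘ f⁻¹`. -/
def GValue (q m x₁ y₁ : ℚ) (P : (E q m).Point) (a : ℚ) : Prop :=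
  ∃ v : ℚ, XInvValue q m x₁ y₁ P v ∧ a = (x₁ ^ 2 - q) * (v ^ 2 - q)

/-- Congruence of nonzero rationals modulo the subgroup `(ℚ*) ^ 2` of `ℚ*`. -/
def CongrModSq (a b : ℚ) : Prop :=
  a ≠ 0 ∧ b ≠ 0 ∧ ∃ r : ℚ, r ≠ 0 ∧ a = b * r ^ 2

end DqQuad

/-!
Write `u = y ^ 2 - q`, `u₁ = y₁ ^ 2 - q`. On `D_m` the first coordinate of `f` is a square up to the
factor `u₁ u`: one has `T = u₁ u (x + x₁) ^ 2 / (y - y₁) ^ 2` (`fT_eq`). Since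
`g = (x₁ ^ 2 - q) (x ^ 2 - q)` and `(x ^ 2 - q) u = (x₁ ^ 2 - q) u₁ = m`, this says that
`g * T = (m (x + x₁) / (y - y₁)) ^ 2`, so that `g` and `T` agree modulo squares of functions. The map
`P ↦ T(P)` is the classical descent homomorphism for the 2-torsion point `(0, 0)`: the abscissas of
three collinear points have a square as product (`exists_descent_mul_eq_sq`). As `T ↦ 1` at infinity
and at `(0, 0)`, it remains to show `g(P) ≡ T(P)` at each rational point where `g` is regular
and nonzero (`GValue.congrModSq_descent`).

To evaluate `g` at every point, `x ∘ f⁻¹` is written as the quotient `xNum / xDen` of two linear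
functions on `E_m`, whose only common zero is one base point. The involution `(x, y) ↦ (-x, -y)` of
`D_m` is translation by `(0, 0)` on `E_m`, which turns this quotient into a second one with another
base point; two more expressions cover infinity when `y₁ = 0` and `(0, 0)` when `x₁ = 0`. Along each
of them `g * T` is a square, and a rational zero of the denominator that is not a base point makes
`q` a square (`exists_isXInvCoords`). That `g` has only one value at a point holds because a form
vanishing on the image of `f` has infinitely many zeros on the curve, hence is zero in the
coordinate ring (`eq_zero_of_infinite`); at infinity a comparison of pole orders, measured by degrees
of norms, is needed (`eval_infinity_eq_zero`).
-/

namespace DqQuad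

/-! ### The quartic curve and its image -/

section Field

variable {K : Type*} [Field K] {q m x₁ y₁ x y : K}

lemma sub_ne_zero_of_onD (hm : m ≠ 0) (h : OnD q m x y) : x ^ 2 - q ≠ 0 ∧ y ^ 2 - q ≠ 0 := by
  unfold OnD at h
  constructor <;> rintro h0 <;> simp [h0] at h <;> exact hm h.symm

lemma sq_ne_sq_of_onD (hm : m ≠ 0) (h₁ : OnD q m x₁ y₁) (h : OnD q m x y)
    (hy : y ^ 2 ≠ y₁ ^ 2) : x ^ 2 ≠ x₁ ^ 2 := by
  intro hx
  have h0 := (sub_ne_zero_of_onD hm h₁).1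
  unfold OnD at h h₁
  rw [hx] at h
  exact hy (sub_left_injective (mul_left_cancel₀ h0 (h.trans h₁.symm)))

lemma fT_eq (h₁ : OnD q m x₁ y₁) (h : OnD q m x y) :
    fT q x₁ y₁ x y = (y₁ ^ 2 - q) * (y ^ 2 - q) * (x + x₁) ^ 2 / (y - y₁) ^ 2 := by
  unfold OnD at h h₁
  unfold fT
  rw [← mul_div_assoc]
  congr 1
  linear_combination (y₁ ^ 2 - q) * (h₁ - h)

lemma fT_ne_zero (hm : m ≠ 0) (h₁ : OnD q m x₁ y₁) (h : OnD q m x y) (hy : y ^ 2 ≠ y₁ ^ 2) :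
    fT q x₁ y₁ x y ≠ 0 := by
  have hx := sq_ne_sq_of_onD hm h₁ h hy
  have h1 : x + x₁ ≠ 0 := fun h => hx (by linear_combination (x - x₁) * h)
  have h2 : y - y₁ ≠ 0 := fun h => hy (by linear_combination (y + y₁) * h)
  rw [fT_eq h₁ h]
  exact div_ne_zero (mul_ne_zero (mul_ne_zero (sub_ne_zero_of_onD hm h₁).2
    (sub_ne_zero_of_onD hm h).2) (pow_ne_zero 2 h1)) (pow_ne_zero 2 h2)

/-- The right-hand side of the equation of `E_m`, divided by `T`. -/
def quad (q m T : K) : K := T ^ 2 + (4 * q ^ 2 - 2 * m) * T + m ^ 2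

/-- The involution `(x, y) ↦ (-x, -y)` of `D_m` becomes translation by `(0, 0)` on `E_m`. -/
lemma fT_neg_neg (h₁ : OnD q m x₁ y₁) (h : OnD q m x y)
    (hy : y ^ 2 ≠ y₁ ^ 2) : fT q x₁ y₁ (-x) (-y) * fT q x₁ y₁ x y = m ^ 2 := by
  have h2 : y - y₁ ≠ 0 := fun h => hy (by linear_combination (y + y₁) * h)
  have h3 : y + y₁ ≠ 0 := fun h => hy (by linear_combination (y - y₁) * h)
  have h3' : -y - y₁ ≠ 0 := fun h => h3 (by linear_combination -h)
  have h' : OnD q m (-x) (-y) := by simpa [OnD] using h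
  rw [fT_eq h₁ h, fT_eq h₁ h', div_mul_div_comm, div_eq_iff (by positivity)]
  unfold OnD at h h₁
  have e : (y ^ 2 - q) * (x ^ 2 - x₁ ^ 2) = -(x₁ ^ 2 - q) * (y ^ 2 - y₁ ^ 2) := by
    linear_combination h - h₁
  rw [← h₁]
  linear_combination (y₁ ^ 2 - q) ^ 2 * ((y ^ 2 - q) * (x ^ 2 - x₁ ^ 2) -
    (x₁ ^ 2 - q) * (y ^ 2 - y₁ ^ 2)) * e

lemma fW_neg_neg (h₁ : OnD q m x₁ y₁) (h : OnD q m x y)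
    (hy : y ^ 2 ≠ y₁ ^ 2) :
    fW q x₁ y₁ (-x) (-y) * fT q x₁ y₁ x y ^ 2 = -(m ^ 2 * fW q x₁ y₁ x y) := by
  rw [← fT_neg_neg h₁ h hy]
  unfold fW
  have e : (2 * y₁ * -x * (q - (-y) ^ 2) + 2 * x₁ * -y * (q - y₁ ^ 2)) / ((-y) ^ 2 - y₁ ^ 2) =
    -((2 * y₁ * x * (q - y ^ 2) + 2 * x₁ * y * (q - y₁ ^ 2)) / (y ^ 2 - y₁ ^ 2)) := by
    rw [neg_sq, ← neg_div]
    congr 1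
    ring
  rw [e]
  ring

lemma fT_mul_sq (h₁ : OnD q m x₁ y₁) (h : OnD q m x y) (hy : y ^ 2 ≠ y₁ ^ 2) :
    fT q x₁ y₁ x y * (y ^ 2 - y₁ ^ 2) ^ 2 =
      (y₁ ^ 2 - q) * (y ^ 2 - q) * ((x + x₁) * (y + y₁)) ^ 2 := by
  have h2 : y - y₁ ≠ 0 := fun h => hy (by linear_combination (y + y₁) * h)
  rw [fT_eq h₁ h, div_mul_eq_mul_div, div_eq_iff (by positivity)]
  ring

lemma equation_fT_fW (h₁ : OnD q m x₁ y₁) (h : OnD q m x y)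
    (hy : y ^ 2 ≠ y₁ ^ 2) :
    fW q x₁ y₁ x y ^ 2 = fT q x₁ y₁ x y * quad q m (fT q x₁ y₁ x y) := by
  have hD : y ^ 2 - y₁ ^ 2 ≠ 0 := sub_ne_zero.2 hy
  have h' : OnD q m (-x) (-y) := by simpa [OnD] using h
  have e₁ := fT_mul_sq h₁ h hy
  have e₂ := fT_mul_sq h₁ h' (by rwa [neg_sq])
  have e₃ := fT_neg_neg h₁ h hy
  unfold fW quad
  generalize fT q x₁ y₁ x y = T at *
  generalize fT q x₁ y₁ (-x) (-y) = T' at *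
  unfold OnD at h h₁
  rw [mul_pow, div_pow, ← mul_div_assoc, div_eq_iff (pow_ne_zero 2 hD), ← e₃, ← h₁]
  have e : (y ^ 2 - q) * (x ^ 2 - x₁ ^ 2) = -(x₁ ^ 2 - q) * (y ^ 2 - y₁ ^ 2) := by
    linear_combination h - h₁
  have k : (2 * y₁ * x * (q - y ^ 2) + 2 * x₁ * y * (q - y₁ ^ 2)) ^ 2 =
      (T + T' + (4 * q ^ 2 - 2 * ((x₁ ^ 2 - q) * (y₁ ^ 2 - q)))) * (y ^ 2 - y₁ ^ 2) ^ 2 := by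
    linear_combination -e₁ - e₂ + 2 * (y₁ ^ 2 - q) * (y ^ 2 - y₁ ^ 2) * e
      + 4 * q * (y ^ 2 - y₁ ^ 2) * (h - h₁)
  linear_combination T ^ 2 * k

/-! ### The coordinate function `x` on the elliptic curve -/

/-- Numerator of `x ∘ f⁻¹` as a quotient of two affine linear functions of `(T, W)`. -/
def xNum (q m x₁ y₁ T W : K) : K :=
  x₁ * y₁ * W + (x₁ ^ 2 * y₁ ^ 2 - q * x₁ ^ 2 - 2 * q * y₁ ^ 2) * T - x₁ ^ 2 * m * (y₁ ^ 2 - q)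

/-- Denominator of `x ∘ f⁻¹` as a quotient of two affine linear functions of `(T, W)`. -/
def xDen (q m x₁ y₁ T W : K) : K :=
  y₁ * W - x₁ * (y₁ ^ 2 + q) * T + x₁ * m * (y₁ ^ 2 - q)

lemma xNum_eq_mul_xDen (h₁ : OnD q m x₁ y₁) (h : OnD q m x y) (hy : y ^ 2 ≠ y₁ ^ 2) :
    xNum q m x₁ y₁ (fT q x₁ y₁ x y) (fW q x₁ y₁ x y) =
      x * xDen q m x₁ y₁ (fT q x₁ y₁ x y) (fW q x₁ y₁ x y) := by
  have hD : y ^ 2 - y₁ ^ 2 ≠ 0 := sub_ne_zero.2 hy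
  have e₁ := fT_mul_sq h₁ h hy
  have e : (y ^ 2 - q) * (x ^ 2 - x₁ ^ 2) = -(x₁ ^ 2 - q) * (y ^ 2 - y₁ ^ 2) := by
    unfold OnD at h h₁
    linear_combination h - h₁
  unfold xNum xDen fW
  rw [← sub_eq_zero]
  refine (mul_eq_zero.1 ?_).resolve_right (pow_ne_zero 3 hD)
  generalize fT q x₁ y₁ x y = T at *
  have k : (2 * y₁ * x * (q - y ^ 2) + 2 * x₁ * y * (q - y₁ ^ 2)) / (y ^ 2 - y₁ ^ 2) *
      (y ^ 2 - y₁ ^ 2) = 2 * y₁ * x * (q - y ^ 2) + 2 * x₁ * y * (q - y₁ ^ 2) :=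
    div_mul_cancel₀ _ hD
  generalize (2 * y₁ * x * (q - y ^ 2) + 2 * x₁ * y * (q - y₁ ^ 2)) / (y ^ 2 - y₁ ^ 2) = r at *
  unfold OnD at h h₁
  -- the identity to which everything reduces once `T` and `W / T` are cleared
  have l : -(2 * (x₁ ^ 2 - q) * y₁ * (y₁ * x * (y ^ 2 - q) + x₁ * y * (y₁ ^ 2 - q))) +
      (y ^ 2 - q) * (x + x₁) * (x₁ ^ 2 * y₁ ^ 2 - q * x₁ ^ 2 - 2 * q * y₁ ^ 2 +
        x * x₁ * (y₁ ^ 2 + q)) = x₁ * m * (y - y₁) ^ 2 := by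
    linear_combination ((y ^ 2 - q) * x₁ - 2 * y * y₁ * x₁) * h₁ + (y₁ ^ 2 + q) * x₁ * h
  linear_combination (y ^ 2 - y₁ ^ 2) * ((x₁ - x) * y₁ * r + (x₁ ^ 2 * y₁ ^ 2 - q * x₁ ^ 2 -
      2 * q * y₁ ^ 2 + x * x₁ * (y₁ ^ 2 + q))) * e₁
    + (y₁ ^ 2 - q) * (y ^ 2 - q) * (x + x₁) ^ 2 * (y + y₁) ^ 2 * (x₁ - x) * y₁ * k
    - (y₁ ^ 2 - q) * (x + x₁) * (y + y₁) ^ 2 * y₁ *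
      (2 * y₁ * x * (q - y ^ 2) + 2 * x₁ * y * (q - y₁ ^ 2)) * e
    + (y₁ ^ 2 - q) * (x + x₁) * (y + y₁) ^ 2 * (y ^ 2 - y₁ ^ 2) * l

/-- Numerator of the second expression for `x ∘ f⁻¹`, obtained from the first one by translation
by `(0, 0)`, which changes the sign of `x`. -/
def xNum' (q m x₁ y₁ T W : K) : K :=
  x₁ * y₁ * m * W - (x₁ ^ 2 * y₁ ^ 2 - q * x₁ ^ 2 - 2 * q * y₁ ^ 2) * m * T +
    x₁ ^ 2 * (y₁ ^ 2 - q) * T ^ 2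

/-- Denominator of the second expression for `x ∘ f⁻¹`. -/
def xDen' (q m x₁ y₁ T W : K) : K :=
  -(y₁ * m * W) - x₁ * (y₁ ^ 2 + q) * m * T + x₁ * (y₁ ^ 2 - q) * T ^ 2

lemma mul_xNum' {T W T' W' : K} (hT : T' * T = m ^ 2) (hW : W' * T ^ 2 = -(m ^ 2 * W)) :
    m * xNum' q m x₁ y₁ T W = -(xNum q m x₁ y₁ T' W' * T ^ 2) := by
  unfold xNum xNum'
  linear_combination (x₁ ^ 2 * y₁ ^ 2 - q * x₁ ^ 2 - 2 * q * y₁ ^ 2) * T * hT + x₁ * y₁ * hW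

lemma mul_xDen' {T W T' W' : K} (hT : T' * T = m ^ 2) (hW : W' * T ^ 2 = -(m ^ 2 * W)) :
    m * xDen' q m x₁ y₁ T W = xDen q m x₁ y₁ T' W' * T ^ 2 := by
  unfold xDen xDen'
  linear_combination x₁ * (y₁ ^ 2 + q) * T * hT - y₁ * hW

lemma xNum'_eq_mul_xDen' (hm : m ≠ 0) (h₁ : OnD q m x₁ y₁) (h : OnD q m x y)
    (hy : y ^ 2 ≠ y₁ ^ 2) :
    xNum' q m x₁ y₁ (fT q x₁ y₁ x y) (fW q x₁ y₁ x y) =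
      x * xDen' q m x₁ y₁ (fT q x₁ y₁ x y) (fW q x₁ y₁ x y) := by
  have h' : OnD q m (-x) (-y) := by simpa [OnD] using h
  have e := xNum_eq_mul_xDen h₁ h' (by rwa [neg_sq])
  have eT := fT_neg_neg h₁ h hy
  have eW := fW_neg_neg h₁ h hy
  apply mul_left_cancel₀ hm
  rw [mul_xNum' eT eW, e, mul_left_comm, mul_xDen' eT eW]
  ring

/-- The two expressions for `x ∘ f⁻¹` have no common base point with `T ≠ 0`. -/
lemma exists_ne_zero (h2 : (2 : K) ≠ 0) (hq : q ≠ 0) (hm : m ≠ 0) (hxy : x₁ ^ 2 + y₁ ^ 2 ≠ 0)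
    {T W : K} (hT : T ≠ 0) :
    (xNum q m x₁ y₁ T W ≠ 0 ∨ xDen q m x₁ y₁ T W ≠ 0) ∨
      (xNum' q m x₁ y₁ T W ≠ 0 ∨ xDen' q m x₁ y₁ T W ≠ 0) := by
  by_contra! H
  obtain ⟨⟨a, b⟩, c, d⟩ := H
  unfold xNum at a
  unfold xDen at b
  unfold xNum' at c
  unfold xDen' at d
  have : 2 * 2 * q * m * (x₁ ^ 2 + y₁ ^ 2) * T = 0 := by
    linear_combination c - x₁ * d - m * a - m * x₁ * b
  simp_all

/-- The point `(T, W)` determines the abscissa of its preimages on `D_m`. -/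
lemma eq_of_fT_eq_of_fW_eq (h2 : (2 : K) ≠ 0) (hq : q ≠ 0) (hm : m ≠ 0)
    (hxy : x₁ ^ 2 + y₁ ^ 2 ≠ 0) (h₁ : OnD q m x₁ y₁) (h : OnD q m x y) (hy : y ^ 2 ≠ y₁ ^ 2)
    {x' y' : K} (h' : OnD q m x' y') (hy' : y' ^ 2 ≠ y₁ ^ 2)
    (hT : fT q x₁ y₁ x y = fT q x₁ y₁ x' y') (hW : fW q x₁ y₁ x y = fW q x₁ y₁ x' y') :
    x = x' := by
  have a := xNum_eq_mul_xDen h₁ h hy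
  have b := xNum'_eq_mul_xDen' hm h₁ h hy
  have a' := xNum_eq_mul_xDen h₁ h' hy'
  have b' := xNum'_eq_mul_xDen' hm h₁ h' hy'
  have key := exists_ne_zero h2 hq hm hxy (W := fW q x₁ y₁ x y) (fT_ne_zero hm h₁ h hy)
  rw [← hT, ← hW] at a' b'
  by_contra hne
  have c := sub_ne_zero.2 hne
  have d₁ := (mul_eq_zero.1 (show (x - x') * xDen q m x₁ y₁ _ _ = 0 by
    linear_combination a' - a)).resolve_left c
  have d₂ := (mul_eq_zero.1 (show (x - x') * xDen' q m x₁ y₁ _ _ = 0 by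
    linear_combination b' - b)).resolve_left c
  simp_all

/-! ### The values of `g` modulo squares -/

/-- The relation `g * T = h ^ 2` on `E_m`, cleared of the denominator `xDen` of `h`. Here `h` is the
function `m (x + x₁) / (y - y₁)` of `D_m`. -/
lemma xNum_xDen_mul_eq_sq (h₁ : OnD q m x₁ y₁) {T W : K} (h : W ^ 2 = T * quad q m T) :
    (x₁ ^ 2 - q) * (xNum q m x₁ y₁ T W ^ 2 - q * xDen q m x₁ y₁ T W ^ 2) * T =
      ((x₁ ^ 2 - q) * y₁ * T ^ 2 + x₁ * m * W - y₁ * m * (x₁ ^ 2 + q) * T) ^ 2 := by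
  unfold OnD at h₁
  unfold quad at h
  unfold xNum xDen
  subst h₁
  linear_combination ((x₁ ^ 2 - q) ^ 2 * y₁ ^ 2 * T -
    x₁ ^ 2 * ((x₁ ^ 2 - q) * (y₁ ^ 2 - q)) ^ 2) * h

/-- The poles of `x ∘ f⁻¹` correspond to the points of `D_m` with `x = ∞`, hence `y ^ 2 = q`. -/
lemma isSquare_of_xDen_eq_zero (h2 : (2 : K) ≠ 0) (hm : m ≠ 0) (hmq : m ≠ q ^ 2)
    (h₁ : OnD q m x₁ y₁) {T W : K} (h : W ^ 2 = T * quad q m T)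
    (hD : xDen q m x₁ y₁ T W = 0) (hN : xNum q m x₁ y₁ T W ≠ 0) : IsSquare q := by
  have hs := (sub_ne_zero_of_onD hm h₁).1
  unfold OnD at h₁
  unfold quad at h
  unfold xNum at hN
  unfold xDen at hD
  by_cases hy : y₁ = 0
  · subst hy
    have hq : q ≠ 0 := by rintro rfl; apply hm; rw [← h₁]; ring
    have hx : x₁ ≠ 0 := by rintro rfl; apply hmq; rw [← h₁]; ring
    have hT : T = -m := by
      have : x₁ * q * (T + m) = 0 := by linear_combination -hD
      have := (mul_eq_zero.1 this).resolve_left (mul_ne_zero hx hq)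
      linear_combination this
    subst hT
    refine (isSquare_iff_exists_sq q).2 ⟨W / (2 * m * x₁), ?_⟩
    rw [div_pow, eq_div_iff (by positivity), h]
    linear_combination -4 * m ^ 2 * h₁
  · -- Eliminating `W` between the equation of `E_m` and `xDen = 0` gives a cubic in `T`: one root
    -- belongs to the base point, the other two are conjugate under `√q ↦ -√q`.
    have hR : y₁ ^ 2 * T - x₁ ^ 2 * (y₁ ^ 2 - q) ^ 2 ≠ 0 := by
      intro h0
      apply hN
      rw [← h₁] at hD ⊢
      linear_combination x₁ * hD + 2 * (x₁ ^ 2 - q) * h0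
    have : (y₁ ^ 2 * T - x₁ ^ 2 * (y₁ ^ 2 - q) ^ 2) *
        ((T - (y₁ ^ 2 + q) * (x₁ ^ 2 - q)) ^ 2 - 4 * (x₁ ^ 2 - q) ^ 2 * y₁ ^ 2 * q) = 0 := by
      rw [← h₁] at hD h
      linear_combination -y₁ ^ 2 * h + (y₁ * W + x₁ * (y₁ ^ 2 + q) * T -
        x₁ * ((x₁ ^ 2 - q) * (y₁ ^ 2 - q)) * (y₁ ^ 2 - q)) * hD
    have := (mul_eq_zero.1 this).resolve_left hR
    refine (isSquare_iff_exists_sq q).2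
      ⟨(T - (y₁ ^ 2 + q) * (x₁ ^ 2 - q)) / (2 * (x₁ ^ 2 - q) * y₁), ?_⟩
    rw [div_pow, eq_div_iff (by positivity)]
    linear_combination -this

end Field

/-! ### Forms on a Weierstrass curve -/

section Forms

open Polynomial WeierstrassCurve.Affine

variable {F : Type*} [Field F] (W : WeierstrassCurve.Affine F)

/-- Dehomogenization of forms in three variables, with values in the affine coordinate ring. -/
noncomputable def dehom : MvPolynomial (Fin 3) F →ₐ[F] W.CoordinateRing :=
  MvPolynomial.aeval ![CoordinateRing.mk W (C X), CoordinateRing.mk W X, 1]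

/-- Evaluation of elements of the affine coordinate ring at a point of the curve. -/
noncomputable def evalPoint {K : Type*} [Field K] [Algebra F K] (t w : K)
    (h : W.polynomial.eval₂ (aeval t : F[X] →ₐ[F] K).toRingHom w = 0) : W.CoordinateRing →+* K :=
  AdjoinRoot.lift (aeval t : F[X] →ₐ[F] K).toRingHom w h

variable {W}

lemma evalPoint_dehom {K : Type*} [Field K] [Algebra F K] {t w : K}
    (h : W.polynomial.eval₂ (aeval t : F[X] →ₐ[F] K).toRingHom w = 0)
    (G : MvPolynomial (Fin 3) F) :
    evalPoint W t w h (dehom W G) = MvPolynomial.aeval ![t, w, 1] G := by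
  suffices (evalPoint W t w h).comp (dehom W).toRingHom =
      (MvPolynomial.aeval ![t, w, 1] : MvPolynomial (Fin 3) F →ₐ[F] K).toRingHom from
    congr($this G)
  apply MvPolynomial.ringHom_ext
  · intro r
    have : algebraMap F W.CoordinateRing r = CoordinateRing.mk W (C (C r)) := rfl
    simp [dehom, evalPoint, this]
  · intro i
    fin_cases i <;> simp [dehom, evalPoint]

/-- An element of the coordinate ring with infinitely many zeros vanishes, because its norm to the
polynomials in the first coordinate does. -/
lemma eq_zero_of_infinite {K : Type*} [Field K] [Algebra F K] {z : W.CoordinateRing}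
    {S : Set K} (hS : S.Infinite) (hz : ∀ t ∈ S, ∃ w, ∃ h :
      W.polynomial.eval₂ (aeval t : F[X] →ₐ[F] K).toRingHom w = 0, evalPoint W t w h z = 0) :
    z = 0 := by
  have hn : Algebra.norm F[X] z = 0 := by
    by_contra hne
    refine hS (((Algebra.norm F[X] z).rootSet_finite K).subset fun t ht => ?_)
    obtain ⟨w, h, hw⟩ := hz t ht
    rw [mem_rootSet]
    refine ⟨hne, ?_⟩
    have e : evalPoint W t w h (algebraMap F[X] _ (Algebra.norm F[X] z)) =
        aeval t (Algebra.norm F[X] z) := by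
      change evalPoint W t w h (AdjoinRoot.of _ _) = _
      simp [evalPoint]
    rw [← e]
    obtain ⟨p, r, rfl⟩ := CoordinateRing.exists_smul_basis_eq z
    change evalPoint W t w h (CoordinateRing.mk W (C (Algebra.norm F[X] _))) = 0
    -- the norm is the product of `z` with its conjugate
    have k := CoordinateRing.coe_norm_smul_basis (W' := W) p r
    have k' : CoordinateRing.mk W (C p + C r * X) =
        p • (1 : W.CoordinateRing) + r • CoordinateRing.mk W X := by
      simp only [CoordinateRing.smul, map_add, map_mul, mul_one]
    rw [map_mul, k'] at k
    refine (congrArg (evalPoint W t w h) k).trans ?_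
    rw [map_mul, hw, zero_mul]
  have := Module.Finite.of_basis (CoordinateRing.basis W)
  exact Algebra.norm_eq_zero_iff.1 hn

lemma degree_norm_add_lt {z z' : W.CoordinateRing} {n : WithBot ℕ}
    (h : (Algebra.norm F[X] z).degree < n) (h' : (Algebra.norm F[X] z').degree < n) :
    (Algebra.norm F[X] (z + z')).degree < n := by
  obtain ⟨p, r, rfl⟩ := CoordinateRing.exists_smul_basis_eq z
  obtain ⟨p', r', rfl⟩ := CoordinateRing.exists_smul_basis_eq z'
  rw [add_add_add_comm, ← add_smul, ← add_smul]
  rw [CoordinateRing.degree_norm_smul_basis, max_lt_iff] at *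
  constructor
  · rcases le_total p.degree p'.degree with hp | hp
    · grw [degree_add_le, max_eq_right hp]
      exact h'.1
    · grw [degree_add_le, max_eq_left hp]
      exact h.1
  · rcases le_total r.degree r'.degree with hr | hr
    · grw [degree_add_le, max_eq_right hr]
      exact h'.2
    · grw [degree_add_le, max_eq_left hr]
      exact h.2

lemma degree_norm_mk_X : (Algebra.norm F[X] (CoordinateRing.mk W (C X))).degree = 2 := by
  have := CoordinateRing.degree_norm_smul_basis (W' := W) X 0
  simpa [CoordinateRing.smul] using this

lemma degree_norm_mk_Y : (Algebra.norm F[X] (CoordinateRing.mk W X)).degree = 3 := by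
  have := CoordinateRing.degree_norm_smul_basis (W' := W) 0 1
  simpa [CoordinateRing.smul] using this

lemma degree_norm_algebraMap {c : F} (hc : c ≠ 0) :
    (Algebra.norm F[X] (algebraMap F W.CoordinateRing c)).degree = 0 := by
  have := CoordinateRing.degree_norm_smul_basis (W' := W) (C c) 0
  have e : algebraMap F W.CoordinateRing c = CoordinateRing.mk W (C (C c)) := rfl
  rw [e]
  simpa [CoordinateRing.smul, hc] using this

/-- The pole order at infinity shows that a form vanishing on the affine part of the curve also
vanishes at the point at infinity: among the monomials of degree `n`, only `Y ^ n` has a pole of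
order `3 n`. -/
lemma eval_infinity_eq_zero {n : ℕ} {G : MvPolynomial (Fin 3) F} (hG : G.IsHomogeneous n)
    (h : dehom W G = 0) : MvPolynomial.eval ![0, 1, 0] G = 0 := by
  have hmon : ∀ d ∈ G.support, (Algebra.norm F[X] (dehom W (MvPolynomial.monomial d (G.coeff d)) -
      algebraMap F _ (MvPolynomial.eval ![0, 1, 0] (MvPolynomial.monomial d (G.coeff d))) *
        CoordinateRing.mk W X ^ n)).degree < ((3 * n : ℕ) : WithBot ℕ) := by
    intro d hd
    have hc := MvPolynomial.mem_support_iff.1 hd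
    have hn : d 0 + d 1 + d 2 = n := by
      have := (DFunLike.congr_fun Finsupp.degree_eq_weight_one d).trans (hG hc)
      rwa [Finsupp.degree_eq_sum, Fin.sum_univ_three] at this
    rw [dehom, MvPolynomial.aeval_monomial, MvPolynomial.eval_monomial,
      Finsupp.prod_fintype _ _ (by simp), Finsupp.prod_fintype _ _ (by simp),
      Fin.prod_univ_three, Fin.prod_univ_three]
    by_cases h0 : d 0 = 0 ∧ d 2 = 0
    · have h1 : d 1 = n := by omega
      have := Module.Finite.of_basis (CoordinateRing.basis W)
      simp [h0, h1, Algebra.norm_zero, -Nat.cast_mul]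
    · have : (0 : F) ^ d 0 * 0 ^ d 2 = 0 := by
        rw [mul_eq_zero, zero_pow_eq_zero, zero_pow_eq_zero]
        omega
      simp only [Matrix.cons_val_zero, Matrix.cons_val_one, Matrix.cons_val, one_pow, mul_one,
        this, mul_zero, map_zero, zero_mul, sub_zero, map_mul, map_pow, degree_mul, degree_pow,
        degree_norm_mk_X, degree_norm_mk_Y, degree_norm_algebraMap hc, zero_add]
      rw [nsmul_eq_mul, nsmul_eq_mul]
      norm_cast
      omega
  have hsum : ∀ s ⊆ G.support, (Algebra.norm F[X] (∑ d ∈ s,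
      (dehom W (MvPolynomial.monomial d (G.coeff d)) -
      algebraMap F _ (MvPolynomial.eval ![0, 1, 0] (MvPolynomial.monomial d (G.coeff d))) *
        CoordinateRing.mk W X ^ n))).degree < ((3 * n : ℕ) : WithBot ℕ) := by
    intro s
    induction s using Finset.induction_on with
    | empty =>
      have := Module.Finite.of_basis (CoordinateRing.basis W)
      simp [Algebra.norm_zero, -Nat.cast_mul]
    | insert d s hd ih =>
      intro hs
      rw [Finset.sum_insert hd]
      exact degree_norm_add_lt (hmon d (hs (Finset.mem_insert_self d s)))
        (ih ((Finset.subset_insert d s).trans hs))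
  have key := hsum _ subset_rfl
  rw [Finset.sum_sub_distrib, ← Finset.sum_mul, ← map_sum, ← map_sum, ← map_sum,
    ← MvPolynomial.as_sum, h, zero_sub, ← neg_mul, ← map_neg] at key
  by_contra hne
  rw [map_mul, map_pow, degree_mul, degree_pow, degree_norm_mk_Y,
    degree_norm_algebraMap (neg_ne_zero.2 hne), zero_add] at key
  rw [nsmul_eq_mul] at key
  norm_cast at key
  omega

end Forms

/-! ### The descent map -/

section Descent

open WeierstrassCurve.Affine

variable {q m : ℚ}

lemma eq_mul_quad {T W : ℚ} (h : (E q m).Nonsingular T W) : W ^ 2 = T * quad q m T := by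
  have := (equation_iff _ _).1 h.1
  simp only [E] at this
  unfold quad
  linear_combination this

/-- Representative of the class of a point under the descent map `E_m(ℚ) → ℚˣ / (ℚˣ)²`, which is
`T` away from `T = 0, ∞`. At `(0, 0)` the class is that of the coefficient `m ^ 2`, thus trivial. -/
def descent : (E q m).Point → ℚ
  | .zero => 1
  | .some T _ _ => if T = 0 then 1 else T

lemma descent_zero : descent (0 : (E q m).Point) = 1 := rfl

lemma descent_some {T W : ℚ} (h : (E q m).Nonsingular T W) :
    descent (.some T W h) = if T = 0 then 1 else T := rfl

lemma descent_ne_zero (P : (E q m).Point) : descent P ≠ 0 := by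
  rcases P with _ | ⟨T, W, h⟩
  · exact one_ne_zero
  · rw [descent_some]
    split_ifs with h0
    exacts [one_ne_zero, h0]

/-- For three collinear points with abscissas `t₁`, `t₂`, `t₃` the product of the abscissas is the
square of the intercept `ν` of their line. If the line passes through `(0, 0)`, one abscissa is `0`
and the other two have product `m ^ 2`. -/
lemma exists_mul_eq_sq_of_collinear {m t₁ t₂ t₃ L ν : ℚ} (hm : m ≠ 0) (e3 : t₁ * t₂ * t₃ = ν ^ 2)
    (e2 : t₁ * t₂ + t₁ * t₃ + t₂ * t₃ = m ^ 2 - 2 * L * ν) :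
    ∃ r, (if t₁ = 0 then 1 else t₁) * (if t₂ = 0 then 1 else t₂) * (if t₃ = 0 then 1 else t₃) =
      r ^ 2 := by
  by_cases hν : ν = 0
  · rw [hν] at e2 e3
    have hm2 : m ^ 2 ≠ 0 := pow_ne_zero 2 hm
    refine ⟨m, ?_⟩
    rcases mul_eq_zero.1 (e3.trans (by ring)) with h | h
    · rcases mul_eq_zero.1 h with h | h
      · have : t₂ * t₃ = m ^ 2 := by rw [h] at e2; linear_combination e2
        have h' := mul_ne_zero_iff.1 (this ▸ hm2)
        rw [if_pos h, if_neg h'.1, if_neg h'.2, one_mul, this]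
      · have : t₁ * t₃ = m ^ 2 := by rw [h] at e2; linear_combination e2
        have h' := mul_ne_zero_iff.1 (this ▸ hm2)
        rw [if_pos h, if_neg h'.1, if_neg h'.2, mul_one, this]
    · have : t₁ * t₂ = m ^ 2 := by rw [h] at e2; linear_combination e2
      have h' := mul_ne_zero_iff.1 (this ▸ hm2)
      rw [if_pos h, if_neg h'.1, if_neg h'.2, mul_one, this]
  · have h' := mul_ne_zero_iff.1 (e3 ▸ pow_ne_zero 2 hν)
    have h'' := mul_ne_zero_iff.1 h'.1
    exact ⟨ν, by rw [if_neg h''.1, if_neg h''.2, if_neg h'.2, e3]⟩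

lemma exists_descent_mul_eq_sq (hm : m ≠ 0) (P Q : (E q m).Point) :
    ∃ r, descent P * descent Q * descent (P + Q) = r ^ 2 := by
  rcases P with _ | ⟨T₁, W₁, h₁⟩
  · refine ⟨descent Q, ?_⟩
    rw [← Point.zero_def, zero_add, descent_zero]
    ring
  rcases Q with _ | ⟨T₂, W₂, h₂⟩
  · refine ⟨descent (.some T₁ W₁ h₁), ?_⟩
    rw [← Point.zero_def, add_zero, descent_zero]
    ring
  by_cases hxy : T₁ = T₂ ∧ W₁ = (E q m).negY T₂ W₂
  · refine ⟨descent (.some T₁ W₁ h₁), ?_⟩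
    rw [Point.add_of_Y_eq hxy.1 hxy.2, descent_zero, descent_some, descent_some, hxy.1]
    ring
  rw [Point.add_some hxy]
  have key (t : ℚ) := congrArg (Polynomial.eval t) (addPolynomial_slope h₁.1 h₂.1 hxy)
  rw [descent_some, descent_some, descent_some]
  generalize (E q m).slope T₁ T₂ W₁ W₂ = L at *
  generalize (E q m).addX T₁ T₂ L = T₃ at *
  simp only [addPolynomial, linePolynomial, polynomial, E, Polynomial.eval_neg,
    Polynomial.eval_mul, Polynomial.eval_sub, Polynomial.eval_X, Polynomial.eval_C,
    Polynomial.eval_add, Polynomial.eval_pow] at key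
  have k0 := key 0
  have k1 := key 1
  have k2 := key (-1)
  refine exists_mul_eq_sq_of_collinear hm (ν := W₁ - L * T₁) (L := L) ?_ ?_
  · linear_combination -k0
  · linear_combination (k1 - k2) / 2

lemma CongrModSq.of_mul_eq_sq {a b r : ℚ} (ha : a ≠ 0) (hb : b ≠ 0) (h : a * b = r ^ 2) :
    CongrModSq a b := by
  refine ⟨ha, hb, r / b, ?_, ?_⟩
  · rintro h0
    rw [div_eq_zero_iff, or_iff_left hb] at h0
    rw [h0] at h
    simp_all
  · rw [div_pow, ← h]
    field_simp

lemma CongrModSq.symm {a b : ℚ} (h : CongrModSq a b) : CongrModSq b a := by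
  obtain ⟨ha, hb, r, hr, rfl⟩ := h
  exact .of_mul_eq_sq hb ha (r := b * r) (by ring)

lemma CongrModSq.trans {a b c : ℚ} (h : CongrModSq a b) (h' : CongrModSq b c) :
    CongrModSq a c := by
  obtain ⟨ha, hb, r, hr, rfl⟩ := h
  obtain ⟨-, hc, s, hs, rfl⟩ := h'
  exact ⟨ha, hc, r * s, mul_ne_zero hr hs, by ring⟩

lemma CongrModSq.mul {a b c d : ℚ} (h : CongrModSq a b) (h' : CongrModSq c d) :
    CongrModSq (a * c) (b * d) := by
  obtain ⟨ha, hb, r, hr, rfl⟩ := h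
  obtain ⟨hc, hd, s, hs, rfl⟩ := h'
  exact ⟨mul_ne_zero ha hc, mul_ne_zero hb hd, r * s, mul_ne_zero hr hs, by ring⟩

lemma congrModSq_descent_add (hm : m ≠ 0) (P Q : (E q m).Point) :
    CongrModSq (descent (P + Q)) (descent P * descent Q) := by
  obtain ⟨r, hr⟩ := exists_descent_mul_eq_sq hm P Q
  exact .of_mul_eq_sq (descent_ne_zero _) (mul_ne_zero (descent_ne_zero P) (descent_ne_zero Q))
    (by rw [mul_comm, hr])

lemma congrModSq_descent_of_sub_eq (hm : m ≠ 0) {P Q S : (E q m).Point} (h : P - Q = 2 • S) :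
    CongrModSq (descent P) (descent Q) := by
  obtain rfl : P = Q + 2 • S := by rw [← h, add_sub_cancel]
  refine (congrModSq_descent_add hm _ _).trans ?_
  rw [two_nsmul]
  obtain ⟨-, -, r, hr, e⟩ := congrModSq_descent_add hm S S
  have hQ := descent_ne_zero Q
  have hS := descent_ne_zero S
  exact ⟨mul_ne_zero hQ (descent_ne_zero _), hQ, descent S * r, mul_ne_zero hS hr,
    by rw [e]; ring⟩

end Descent

/-! ### Regular values of `x ∘ f⁻¹` -/

lemma finite_setOf_sq_eq {K : Type*} [Field K] (c : K) : {w : K | w ^ 2 = c}.Finite := by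
  classical
  refine (Polynomial.nthRoots 2 c).toFinset.finite_toSet.subset fun w hw => ?_
  simpa [Polynomial.mem_nthRoots] using hw

/-- The map `f` has finite fibres, so the abscissas of its image points are infinitely many. -/
lemma infinite_setOf_fT {K : Type*} [Field K] [IsAlgClosed K] {q m x₁ y₁ : K} (h2 : (2 : K) ≠ 0)
    (hq : q ≠ 0) (hm : m ≠ 0) (hxy : x₁ ^ 2 + y₁ ^ 2 ≠ 0) (h₁ : OnD q m x₁ y₁) :
    {t | ∃ x y, OnD q m x y ∧ y ^ 2 ≠ y₁ ^ 2 ∧ fT q x₁ y₁ x y = t}.Infinite := by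
  intro hfin
  have hX : ({x : K | x ^ 2 = q} ∪ {x : K | x ^ 2 = x₁ ^ 2})ᶜ.Infinite :=
    ((finite_setOf_sq_eq q).union (finite_setOf_sq_eq (x₁ ^ 2))).infinite_compl
  choose ρ hρ using fun x : K => IsAlgClosed.exists_pow_nat_eq (q + m / (x ^ 2 - q)) two_pos
  have hD : ∀ x ∈ ({x : K | x ^ 2 = q} ∪ {x : K | x ^ 2 = x₁ ^ 2})ᶜ,
      OnD q m x (ρ x) ∧ ρ x ^ 2 ≠ y₁ ^ 2 := by
    intro x hx
    simp only [Set.mem_compl_iff, Set.mem_union, Set.mem_ofPred_eq, not_or] at hx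
    have hs : x ^ 2 - q ≠ 0 := sub_ne_zero.2 hx.1
    have h : OnD q m x (ρ x) := by
      unfold OnD
      rw [hρ, add_sub_cancel_left, mul_div_cancel₀ _ hs]
    refine ⟨h, fun hy => hx.2 ?_⟩
    have hu := (sub_ne_zero_of_onD hm h₁).2
    unfold OnD at h h₁
    rw [hy] at h
    exact sub_left_injective (mul_right_cancel₀ hu (h.trans h₁.symm))
  have hU : (⋃ t ∈ {t | ∃ x y, OnD q m x y ∧ y ^ 2 ≠ y₁ ^ 2 ∧ fT q x₁ y₁ x y = t},
      Prod.mk t '' {w : K | w ^ 2 = t * quad q m t}).Finite :=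
    hfin.biUnion fun t _ => (finite_setOf_sq_eq _).image _
  obtain ⟨x, hx, x', hx', hne, e⟩ := hX.exists_ne_map_eq_of_mapsTo
    (f := fun x => (fT q x₁ y₁ x (ρ x), fW q x₁ y₁ x (ρ x))) (fun x hx => by
      obtain ⟨h, hy⟩ := hD x hx
      simp only [Set.mem_iUnion]
      exact ⟨_, ⟨x, ρ x, h, hy, rfl⟩, _, equation_fT_fW h₁ h hy, rfl⟩) hU
  rw [Prod.mk.injEq] at e
  exact hne (eq_of_fT_eq_of_fW_eq h2 hq hm hxy h₁ (hD x hx).1 (hD x hx).2 (hD x' hx').1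
    (hD x' hx').2 e.1 e.2)

section Rational

variable {q m x₁ y₁ : ℚ}

lemma OnD.cast (h : OnD q m x₁ y₁) (K : Type*) [Field K] [CharZero K] :
    OnD (q : K) m x₁ y₁ := by
  unfold OnD at *
  exact_mod_cast h

lemma sq_add_sq_ne_zero (hmq : m ≠ q ^ 2) (h : OnD q m x₁ y₁) : x₁ ^ 2 + y₁ ^ 2 ≠ 0 := by
  intro h0
  have hx : x₁ ^ 2 = 0 := by linarith [sq_nonneg x₁, sq_nonneg y₁]
  have hy : y₁ ^ 2 = 0 := by linarith [sq_nonneg x₁, sq_nonneg y₁]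
  apply hmq
  rw [← h, hx, hy]
  ring

lemma eval₂_polynomial_eq_zero {K : Type*} [Field K] [CharZero K] [Algebra ℚ K] {t w : K}
    (h : w ^ 2 = t * quad (q : K) m t) :
    (E q m).polynomial.eval₂ (Polynomial.aeval t : Polynomial ℚ →ₐ[ℚ] K).toRingHom w = 0 := by
  unfold quad at h
  simp [WeierstrassCurve.Affine.polynomial, E, Polynomial.eval₂_add, Polynomial.eval₂_pow]
  linear_combination h

/-- A form vanishing on the image of `f` vanishes at all rational points of `E_m`. -/
lemma eval_coords_eq_zero (hq : q ≠ 0) (hm : m ≠ 0) (hmq : m ≠ q ^ 2) (h₁ : OnD q m x₁ y₁)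
    {n : ℕ} {G : MvPolynomial (Fin 3) ℚ} (hG : G.IsHomogeneous n)
    (h : ∀ x y : AlgebraicClosure ℚ, OnD (q : AlgebraicClosure ℚ) m x y →
      y ^ 2 ≠ (y₁ : AlgebraicClosure ℚ) ^ 2 → MvPolynomial.aeval
        ![fT (q : AlgebraicClosure ℚ) x₁ y₁ x y, fW (q : AlgebraicClosure ℚ) x₁ y₁ x y, 1] G = 0)
    (P : (E q m).Point) : MvPolynomial.eval (coords P) G = 0 := by
  have h₁' := h₁.cast (AlgebraicClosure ℚ)
  have hz : dehom (E q m) G = 0 := by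
    refine eq_zero_of_infinite (infinite_setOf_fT (K := AlgebraicClosure ℚ) (q := q) (m := m)
      (x₁ := x₁) (y₁ := y₁) two_ne_zero (by exact_mod_cast hq) (by exact_mod_cast hm)
      (by exact_mod_cast sq_add_sq_ne_zero hmq h₁) h₁') ?_
    rintro _ ⟨x, y, hD, hy, rfl⟩
    refine ⟨_, eval₂_polynomial_eq_zero (equation_fT_fW h₁' hD hy), ?_⟩
    rw [evalPoint_dehom, h x y hD hy]
  rcases P with _ | ⟨T, W, hP⟩
  · exact eval_infinity_eq_zero hG hz
  · have e := evalPoint_dehom (K := ℚ) (eval₂_polynomial_eq_zero (q := q) (m := m)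
      (by simpa using eq_mul_quad hP)) G
    rw [hz, map_zero] at e
    simpa [coords, MvPolynomial.aeval_eq_eval] using e.symm

lemma RepresentsXInv.eval_mul_eval_eq (hq : q ≠ 0) (hm : m ≠ 0) (hmq : m ≠ q ^ 2)
    (h₁ : OnD q m x₁ y₁) {n n' : ℕ} {A B A' B' : MvPolynomial (Fin 3) ℚ}
    (h : RepresentsXInv q m x₁ y₁ n A B) (h' : RepresentsXInv q m x₁ y₁ n' A' B')
    (P : (E q m).Point) :
    MvPolynomial.eval (coords P) A * MvPolynomial.eval (coords P) B' =
      MvPolynomial.eval (coords P) A' * MvPolynomial.eval (coords P) B := by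
  obtain ⟨hA, hB, hAB⟩ := h
  obtain ⟨hA', hB', hAB'⟩ := h'
  have := eval_coords_eq_zero hq hm hmq h₁ ((hA.mul hB').sub (add_comm n' n ▸ hA'.mul hB))
    (fun x y hD hy => by rw [map_sub, map_mul, map_mul, hAB x y hD hy, hAB' x y hD hy]; ring) P
  rwa [map_sub, map_mul, map_mul, sub_eq_zero] at this

open MvPolynomial

lemma isHomogeneous_C_mul_mul (c : ℚ) (i j : Fin 3) :
    (C c * (X i * X j) : MvPolynomial (Fin 3) ℚ).IsHomogeneous 2 :=
  ((isHomogeneous_X ℚ i).mul (isHomogeneous_X ℚ j)).C_mul c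

lemma representsXInv_linear (h₁ : OnD q m x₁ y₁) : RepresentsXInv q m x₁ y₁ 1
    (C (x₁ * y₁) * X 1 + C (x₁ ^ 2 * y₁ ^ 2 - q * x₁ ^ 2 - 2 * q * y₁ ^ 2) * X 0 +
      C (-(x₁ ^ 2 * m * (y₁ ^ 2 - q))) * X 2)
    (C y₁ * X 1 + C (-(x₁ * (y₁ ^ 2 + q))) * X 0 + C (x₁ * m * (y₁ ^ 2 - q)) * X 2) := by
  refine ⟨(((isHomogeneous_C_mul_X _ _).add (isHomogeneous_C_mul_X _ _)).add
    (isHomogeneous_C_mul_X _ _)), (((isHomogeneous_C_mul_X _ _).add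
    (isHomogeneous_C_mul_X _ _)).add (isHomogeneous_C_mul_X _ _)), fun x y h hy => ?_⟩
  have e := xNum_eq_mul_xDen (h₁.cast _) h hy
  unfold xNum xDen at e
  simp
  linear_combination e

lemma representsXInv_quadratic (hm : m ≠ 0) (h₁ : OnD q m x₁ y₁) : RepresentsXInv q m x₁ y₁ 2
    (C (x₁ * y₁ * m) * (X 1 * X 2) +
      C (-((x₁ ^ 2 * y₁ ^ 2 - q * x₁ ^ 2 - 2 * q * y₁ ^ 2) * m)) * (X 0 * X 2) +
      C (x₁ ^ 2 * (y₁ ^ 2 - q)) * (X 0 * X 0))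
    (C (-(y₁ * m)) * (X 1 * X 2) + C (-(x₁ * (y₁ ^ 2 + q) * m)) * (X 0 * X 2) +
      C (x₁ * (y₁ ^ 2 - q)) * (X 0 * X 0)) := by
  refine ⟨(((isHomogeneous_C_mul_mul _ _ _).add (isHomogeneous_C_mul_mul _ _ _)).add
    (isHomogeneous_C_mul_mul _ _ _)), (((isHomogeneous_C_mul_mul _ _ _).add
    (isHomogeneous_C_mul_mul _ _ _)).add (isHomogeneous_C_mul_mul _ _ _)), fun x y h hy => ?_⟩
  have e := xNum'_eq_mul_xDen' (by exact_mod_cast hm) (h₁.cast _) h hy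
  unfold xNum' xDen' at e
  simp
  linear_combination e

/-- If `y₁ = 0`, then `x ∘ f⁻¹ = x₁ (T - m) / (T + m)`; this representation is good at infinity. -/
lemma representsXInv_infinity (hq : q ≠ 0) (hx : x₁ ≠ 0) (h₁ : OnD q m x₁ 0) :
    RepresentsXInv q m x₁ 0 2
      (C x₁ * (X 1 * X 1) + C (-(x₁ * m)) * (X 0 * X 0) +
        C (-(x₁ * m * (4 * q ^ 2 - 2 * m))) * (X 0 * X 2) + C (-(x₁ * m ^ 3)) * (X 2 * X 2))
      (C 1 * (X 1 * X 1) + C m * (X 0 * X 0) +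
        C (m * (4 * q ^ 2 - 2 * m)) * (X 0 * X 2) + C (m ^ 3) * (X 2 * X 2)) := by
  refine ⟨((((isHomogeneous_C_mul_mul _ _ _).add (isHomogeneous_C_mul_mul _ _ _)).add
    (isHomogeneous_C_mul_mul _ _ _)).add (isHomogeneous_C_mul_mul _ _ _)),
    ((((isHomogeneous_C_mul_mul _ _ _).add (isHomogeneous_C_mul_mul _ _ _)).add
    (isHomogeneous_C_mul_mul _ _ _)).add (isHomogeneous_C_mul_mul _ _ _)), fun x y h hy => ?_⟩
  have e := xNum_eq_mul_xDen (h₁.cast _) h hy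
  have k := equation_fT_fW (h₁.cast _) h hy
  unfold xNum xDen at e
  unfold quad at k
  simp only [Rat.cast_zero] at e k ⊢
  generalize fT (q : AlgebraicClosure ℚ) x₁ 0 x y = T at *
  generalize fW (q : AlgebraicClosure ℚ) x₁ 0 x y = W at *
  have hq' : (q : AlgebraicClosure ℚ) ≠ 0 := by exact_mod_cast hq
  have hx' : (x₁ : AlgebraicClosure ℚ) ≠ 0 := by exact_mod_cast hx
  have e' : x₁ * (T - m) = x * (T + m) := by
    apply mul_left_cancel₀ (mul_ne_zero hq' hx')
    linear_combination -e
  simp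
  linear_combination (x₁ - x) * k + (T ^ 2 + (4 * q ^ 2 - 2 * m) * T + m ^ 2) * e'

/-- If `x₁ = 0`, then `x ∘ f⁻¹ = -2 q y₁ T / W`; this representation is good at `(0, 0)`. -/
lemma representsXInv_origin (hm : m ≠ 0) (hy : y₁ ≠ 0) (h₁ : OnD q m 0 y₁) :
    RepresentsXInv q m 0 y₁ 2 (C (-(2 * q * y₁)) * (X 1 * X 2))
      (C 1 * (X 0 * X 0) + C (4 * q ^ 2 - 2 * m) * (X 0 * X 2) + C (m ^ 2) * (X 2 * X 2)) := by
  refine ⟨isHomogeneous_C_mul_mul _ _ _,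
    ((isHomogeneous_C_mul_mul _ _ _).add (isHomogeneous_C_mul_mul _ _ _)).add
    (isHomogeneous_C_mul_mul _ _ _), fun x y h hyy => ?_⟩
  have e := xNum_eq_mul_xDen (h₁.cast _) h hyy
  have k := equation_fT_fW (h₁.cast _) h hyy
  have hT := fT_ne_zero (by exact_mod_cast hm) (h₁.cast _) h hyy
  unfold xNum xDen at e
  unfold quad at k
  simp only [Rat.cast_zero] at e k hT ⊢
  generalize fT (q : AlgebraicClosure ℚ) 0 y₁ x y = T at *
  generalize fW (q : AlgebraicClosure ℚ) 0 y₁ x y = W at *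
  have hy' : (y₁ : AlgebraicClosure ℚ) ≠ 0 := by exact_mod_cast hy
  have e' : -(2 * q * y₁) * T = x * W := by
    apply mul_left_cancel₀ hy'
    linear_combination e
  simp
  apply mul_left_cancel₀ hT
  linear_combination W * e' + x * k

end Rational

/-! ### The homomorphism property of `g` -/

section Main

open MvPolynomial

variable {q m x₁ y₁ : ℚ}

/-- Homogeneous coordinates `(a : b)` of the value of `x ∘ f⁻¹` at `P`, read off from one of its
representations, together with the class of `g` at `P` modulo squares. -/
def IsXInvCoords (q m x₁ y₁ : ℚ) (P : (E q m).Point) (a b : ℚ) : Prop :=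
  (∃ n A B, RepresentsXInv q m x₁ y₁ n A B ∧ eval (coords P) A = a ∧ eval (coords P) B = b) ∧
    (a ≠ 0 ∨ b ≠ 0) ∧ (b = 0 → IsSquare q) ∧
    ∃ r, (x₁ ^ 2 - q) * (a ^ 2 - q * b ^ 2) * descent P = r ^ 2

lemma exists_isXInvCoords_zero (hq : q ≠ 0) (hmq : m ≠ q ^ 2) (h₁ : OnD q m x₁ y₁) :
    ∃ a b, IsXInvCoords q m x₁ y₁ 0 a b := by
  by_cases hy : y₁ = 0
  · subst hy
    have hx : x₁ ≠ 0 := by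
      rintro rfl
      exact sq_add_sq_ne_zero hmq h₁ (by ring)
    refine ⟨x₁, 1, ⟨_, _, _, representsXInv_infinity hq hx h₁, ?_, ?_⟩, .inl hx, by simp,
      x₁ ^ 2 - q, ?_⟩
    · simp [coords]
    · simp [coords]
    · rw [descent_zero]
      ring
  · refine ⟨x₁ * y₁, y₁, ⟨_, _, _, representsXInv_linear h₁, ?_, ?_⟩, .inr hy,
      fun h => (hy h).elim, y₁ * (x₁ ^ 2 - q), ?_⟩
    · simp [coords]
    · simp [coords]
    · rw [descent_zero]
      ring

lemma exists_isXInvCoords_origin (hm : m ≠ 0) (hmq : m ≠ q ^ 2) (h₁ : OnD q m x₁ y₁)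
    (h : (E q m).Nonsingular 0 0) : ∃ a b, IsXInvCoords q m x₁ y₁ (.some 0 0 h) a b := by
  by_cases hx : x₁ = 0
  · subst hx
    have hy : y₁ ≠ 0 := by
      rintro rfl
      exact sq_add_sq_ne_zero hmq h₁ (by ring)
    refine ⟨0, m ^ 2, ⟨_, _, _, representsXInv_origin hm hy h₁, ?_, ?_⟩, .inr (by positivity),
      by simp [hm], q * m ^ 2, ?_⟩
    · simp [coords]
    · simp [coords]
    · rw [descent_some, if_pos rfl]
      ring
  · have hb : x₁ * m * (y₁ ^ 2 - q) ≠ 0 :=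
      mul_ne_zero (mul_ne_zero hx hm) (sub_ne_zero_of_onD hm h₁).2
    refine ⟨-(x₁ ^ 2 * m * (y₁ ^ 2 - q)), x₁ * m * (y₁ ^ 2 - q),
      ⟨_, _, _, representsXInv_linear h₁, ?_, ?_⟩, .inr hb, fun h => (hb h).elim,
      x₁ * m * (y₁ ^ 2 - q) * (x₁ ^ 2 - q), ?_⟩
    · simp [coords]
    · simp [coords]
    · rw [descent_some, if_pos rfl]
      ring

lemma exists_isXInvCoords_of_ne_zero (hq : q ≠ 0) (hm : m ≠ 0) (hmq : m ≠ q ^ 2)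
    (h₁ : OnD q m x₁ y₁) {T W : ℚ} (h : (E q m).Nonsingular T W) (hT : T ≠ 0) :
    ∃ a b, IsXInvCoords q m x₁ y₁ (.some T W h) a b := by
  have hE := eq_mul_quad h
  rcases exists_ne_zero two_ne_zero hq hm (sq_add_sq_ne_zero hmq h₁) (W := W) hT with hne | hne
  · refine ⟨xNum q m x₁ y₁ T W, xDen q m x₁ y₁ T W,
      ⟨_, _, _, representsXInv_linear h₁, ?_, ?_⟩, hne, fun h0 =>
        isSquare_of_xDen_eq_zero two_ne_zero hm hmq h₁ hE h0 (hne.resolve_right (not_not.2 h0)),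
      (x₁ ^ 2 - q) * y₁ * T ^ 2 + x₁ * m * W - y₁ * m * (x₁ ^ 2 + q) * T, ?_⟩
    · simp [coords, xNum]
      ring
    · simp [coords, xDen]
      ring
    · rw [descent_some, if_neg hT]
      exact xNum_xDen_mul_eq_sq h₁ hE
  · -- pass to the translate `(m ^ 2 / T, -m ^ 2 * W / T ^ 2)` of the point by `(0, 0)`
    have eT : m ^ 2 / T * T = m ^ 2 := div_mul_cancel₀ _ hT
    have eW : -(m ^ 2 * W) / T ^ 2 * T ^ 2 = -(m ^ 2 * W) := div_mul_cancel₀ _ (pow_ne_zero 2 hT)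
    have eN := mul_xNum' (q := q) (x₁ := x₁) (y₁ := y₁) eT eW
    have eD := mul_xDen' (q := q) (x₁ := x₁) (y₁ := y₁) eT eW
    have hE' : (-(m ^ 2 * W) / T ^ 2) ^ 2 = m ^ 2 / T * quad q m (m ^ 2 / T) := by
      unfold quad at *
      field_simp
      linear_combination hE
    generalize m ^ 2 / T = T' at *
    generalize -(m ^ 2 * W) / T ^ 2 = W' at *
    have eS := xNum_xDen_mul_eq_sq h₁ hE'
    refine ⟨xNum' q m x₁ y₁ T W, xDen' q m x₁ y₁ T W,
      ⟨_, _, _, representsXInv_quadratic hm h₁, ?_, ?_⟩, hne, fun h0 => ?_, ?_⟩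
    · simp [coords, xNum']
      ring
    · simp [coords, xDen']
      ring
    · have hT2 := pow_ne_zero 2 hT
      have hN := hne.resolve_right (not_not.2 h0)
      rw [h0, mul_zero] at eD
      refine isSquare_of_xDen_eq_zero two_ne_zero hm hmq h₁ hE'
        ((mul_eq_zero.1 eD.symm).resolve_right hT2) fun h0' => ?_
      rw [h0', zero_mul, neg_zero] at eN
      exact (mul_ne_zero hm hN) eN
    · rw [descent_some, if_neg hT]
      refine ⟨((x₁ ^ 2 - q) * y₁ * T' ^ 2 + x₁ * m * W' - y₁ * m * (x₁ ^ 2 + q) * T') *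
        T ^ 3 / m ^ 2, ?_⟩
      rw [div_pow, mul_pow, ← eS, eq_div_iff (by positivity)]
      generalize xNum' q m x₁ y₁ T W = a at *
      generalize xDen' q m x₁ y₁ T W = b at *
      generalize xNum q m x₁ y₁ T' W' = a' at *
      generalize xDen q m x₁ y₁ T' W' = b' at *
      linear_combination (x₁ ^ 2 - q) * T * m ^ 2 * ((m * a - a' * T ^ 2) * eN -
        q * (m * b + b' * T ^ 2) * eD) - (x₁ ^ 2 - q) * (a' ^ 2 - q * b' ^ 2) * T ^ 5 * eT

lemma exists_isXInvCoords (hq : q ≠ 0) (hm : m ≠ 0) (hmq : m ≠ q ^ 2) (h₁ : OnD q m x₁ y₁)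
    (P : (E q m).Point) : ∃ a b, IsXInvCoords q m x₁ y₁ P a b := by
  rcases P with _ | ⟨T, W, h⟩
  · exact exists_isXInvCoords_zero hq hmq h₁
  · by_cases hT : T = 0
    · subst hT
      obtain rfl : W = 0 := by simpa using eq_mul_quad h
      exact exists_isXInvCoords_origin hm hmq h₁ h
    · exact exists_isXInvCoords_of_ne_zero hq hm hmq h₁ h hT

/-- The value of `x ∘ f⁻¹` at a point does not depend on the representation. -/
lemma IsXInvCoords.mul_eq (hq : q ≠ 0) (hm : m ≠ 0) (hmq : m ≠ q ^ 2) (h₁ : OnD q m x₁ y₁)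
    {P : (E q m).Point} {a b v : ℚ} (h : IsXInvCoords q m x₁ y₁ P a b)
    (hv : XInvValue q m x₁ y₁ P v) : b ≠ 0 ∧ a = v * b := by
  obtain ⟨⟨n, A, B, hR, rfl, rfl⟩, hne, -, -⟩ := h
  obtain ⟨n', A', B', hR', hB', rfl⟩ := hv
  have e := hR.eval_mul_eval_eq hq hm hmq h₁ hR' P
  have e' : eval (coords P) A = eval (coords P) A' / eval (coords P) B' * eval (coords P) B := by
    rw [div_mul_eq_mul_div, eq_div_iff hB', e]
  refine ⟨fun h0 => ?_, e'⟩
  rw [h0, mul_zero] at e'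
  exact hne.elim (fun h => h e') fun h => h h0

lemma GValue.congrModSq_descent (hq : q ≠ 0) (hm : m ≠ 0) (hmq : m ≠ q ^ 2)
    (h₁ : OnD q m x₁ y₁) {P : (E q m).Point} {c : ℚ} (h : GValue q m x₁ y₁ P c) (hc : c ≠ 0) :
    CongrModSq c (descent P) := by
  obtain ⟨v, hv, rfl⟩ := h
  obtain ⟨a, b, hab⟩ := exists_isXInvCoords hq hm hmq h₁ P
  obtain ⟨hb, rfl⟩ := hab.mul_eq hq hm hmq h₁ hv
  obtain ⟨r, hr⟩ := hab.2.2.2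
  refine .of_mul_eq_sq hc (descent_ne_zero P) (r := r / b) ?_
  rw [div_pow, ← hr, eq_div_iff (pow_ne_zero 2 hb)]
  ring

lemma exists_gValue_of_not_isSquare (hq : q ≠ 0) (hm : m ≠ 0) (hmq : m ≠ q ^ 2)
    (h₁ : OnD q m x₁ y₁) (hsq : ¬ IsSquare q) (P : (E q m).Point) :
    ∃ a : ℚ, a ≠ 0 ∧ ∀ b : ℚ, GValue q m x₁ y₁ P b ↔ b = a := by
  obtain ⟨a, b, hab⟩ := exists_isXInvCoords hq hm hmq h₁ P
  have hb : b ≠ 0 := fun h => hsq (hab.2.2.1 h)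
  refine ⟨(x₁ ^ 2 - q) * ((a / b) ^ 2 - q), mul_ne_zero (sub_ne_zero_of_onD hm h₁).1
    fun h0 => hsq ((isSquare_iff_exists_sq q).2 ⟨a / b, (sub_eq_zero.1 h0).symm⟩),
    fun c => ⟨?_, ?_⟩⟩
  · rintro ⟨v, hv, rfl⟩
    rw [(hab.mul_eq hq hm hmq h₁ hv).2, mul_div_cancel_right₀ _ hb]
  · rintro rfl
    obtain ⟨⟨n, A, B, hR, rfl, rfl⟩, -⟩ := hab
    exact ⟨_, ⟨n, A, B, hR, hb, rfl⟩, rfl⟩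

end Main

end DqQuad

theorem theorem6 (q m x₁ y₁ : ℚ) (hq : q ≠ 0) (hm : m ≠ 0) (hmq : m ≠ q ^ 2)
    (hP₁ : DqQuad.OnD q m x₁ y₁) :
    -- `g` takes exactly one value, which is nonzero, at every rational point if `q` is no square
    (¬ IsSquare q → ∀ P : (DqQuad.E q m).Point,
      ∃ a : ℚ, a ≠ 0 ∧ ∀ b : ℚ, DqQuad.GValue q m x₁ y₁ P b ↔ b = a) ∧
    -- `g (P + Q) ≡ g (P) * g (Q)`
    (∀ (P Q : (DqQuad.E q m).Point) (a b c : ℚ),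
      DqQuad.GValue q m x₁ y₁ P a → DqQuad.GValue q m x₁ y₁ Q b →
      DqQuad.GValue q m x₁ y₁ (P + Q) c → a ≠ 0 → b ≠ 0 → c ≠ 0 →
      DqQuad.CongrModSq c (a * b)) ∧
    -- `g (P) ≡ g (Q)` if `P ≡ Q` modulo `2 E_m(ℚ)`
    (∀ (P Q : (DqQuad.E q m).Point) (a b : ℚ), (∃ S : (DqQuad.E q m).Point, P - Q = 2 • S) →
      DqQuad.GValue q m x₁ y₁ P a → DqQuad.GValue q m x₁ y₁ Q b → a ≠ 0 → b ≠ 0 →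
      DqQuad.CongrModSq a b) := by
  refine ⟨DqQuad.exists_gValue_of_not_isSquare hq hm hmq hP₁, ?_, ?_⟩
  · intro P Q a b c hPa hQb hc ha0 hb0 hc0
    have hP := hPa.congrModSq_descent hq hm hmq hP₁ ha0
    have hQ := hQb.congrModSq_descent hq hm hmq hP₁ hb0
    have hPQ := hc.congrModSq_descent hq hm hmq hP₁ hc0
    exact (hPQ.trans (DqQuad.congrModSq_descent_add hm P Q)).trans (hP.mul hQ).symm
  · rintro P Q a b ⟨S, hS⟩ hPa hQb ha0 hb0
    have hP := hPa.congrModSq_descent hq hm hmq hP₁ ha0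
    have hQ := hQb.congrModSq_descent hq hm hmq hP₁ hb0
    exact (hP.trans (DqQuad.congrModSq_descent_of_sub_eq hm hS)).trans hQ.symm
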